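/- **Theorem (unsatisfiability of the unsatisfiable core in LTL).** Let $\varphi$ be an unsatisfiable LTL formula, let $C^{uc}$ be an unsatisfiable core (UC) in SNF of $\mathrm{SNF}(\varphi)$, extracted from any execution of the temporal resolution procedure below on $\mathrm{SNF}(\varphi)$ that derives the empty clause, and let $\varphi^{uc}$ be the LTL formula obtained by lifting $C^{uc}$ back to $\varphi$. Then $\varphi^{uc}$ is unsatisfiable. *LTL and SNF.* LTL formulas are built from $0,1$ and atomic propositions with $\neg,\vee,\wedge,\mathbf X,\mathbf U,\mathbf R,\mathbf F,\mathbf G$ and are interpreted over infinite words at time $0$. For finite sets (disjunctions) $P,Q$ of literals and a literal $l$, the SNF clauses are the initial clauses $(P)$, the global clauses $(\mathbf G(P\vee \mathbf X Q))$, written $(\mathbf G(P))$ if $Q=\emptyset$ ("empty $\mathbf X$ part"), and the eventuality clauses $(\mathbf G(P\vee\mathbf F l))$. The clauses $(0)$ and $(\mathbf G(0))$ are called empty, written $\Box$. *Translation.* An occurrence of a subformula $\psi$ of $\varphi$ is referenced by $x_\psi$, which is $\psi$ itself if $\psi$ is $0$, $1$ or an atomic proposition, and a fresh proposition (one per occurrence)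 otherwise. $\mathrm{SNF}(\varphi)$ consists of the initial clause $x_\varphi$ and, for each occurrence of a subformula, with $x$ denoting its own proposition, of the clauses $\mathbf G(\cdot)$ of the following implications (clauses simplified when $0$ or $1$ occurs in them, trivially true ones omitted). Positive polarity: $\neg\psi$: $x\to\neg x_\psi$. $\psi\wedge\psi'$: $x\to x_\psi$; $x\to x_{\psi'}$. $\psi\vee\psi'$: $x\to x_\psi\vee x_{\psi'}$. $\mathbf X\psi$: $x\to\mathbf X x_\psi$. $\mathbf G\psi$: $x\to\mathbf X x$; $x\to x_\psi$. $\mathbf F\psi$: $x\to\mathbf F x_\psi$. $\psi\mathbf U\psi'$: $x\to x_{\psi'}\vee x_\psi$; $x\to x_{\psi'}\vee\mathbf X x$; $x\to\mathbf F x_{\psi'}$. $\psi\mathbf R\psi'$: $x\to x_{\psi'}$; $x\to x_\psi\vee\mathbf X x$. Negative polarity: $\neg\psi$: $\neg x\to x_\psi$. $\psi\wedge\psi'$: $\neg x\to\neg x_\psi\vee\neg x_{\psi'}$. $\psi\vee\psi'$: $\neg x\to\neg x_\psi$; $\neg x\to\neg x_{\psi'}$. $\mathbf X\psi$: $\neg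 x\to\mathbf X\neg x_\psi$. $\mathbf G\psi$: $\neg x\to\mathbf F\neg x_\psi$. $\mathbf F\psi$: $\neg x\to\mathbf X\neg x$; $\neg x\to\neg x_\psi$. $\psi\mathbf U\psi'$: $\neg x\to\neg x_{\psi'}$; $\neg x\to\neg x_\psi\vee\mathbf X\neg x$. $\psi\mathbf R\psi'$: $\neg x\to\neg x_{\psi'}\vee\neg x_\psi$; $\neg x\to\neg x_{\psi'}\vee\mathbf X\neg x$; $\neg x\to\mathbf F\neg x_{\psi'}$. *Temporal resolution with resolution graph.* Input: a finite set $C$ of SNF clauses. The main partition $M$ starts as $C$, with one vertex per clause and no edges. Whenever a rule generates a clause that is new in its partition, a vertex is added for it, with edges from its premises except where stated otherwise. The procedure returns unsat when $\Box\in M$; this is tested at the start and after each saturation of $M$. (1) Saturate $M$, i.e. apply until nothing new arises: from $(P\vee l)$ and $(\neg l\vee Q)$ or $(\mathbf G(\neg l\vee Q))$ derive $(P\vee Q)$; from $(\mathbf G(P\vee l))$ and $(\mathbf G(\neg l\vee Q))$ derive $(\mathbf G(P\vee Q))$; from $(\mathbf G(P\vee l))$ and $(\mathbf G(Q\vee\mathbf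 X(\neg l\vee R)))$ derive $(\mathbf G(Q\vee\mathbf X(P\vee R)))$; and (step-xx) from $(\mathbf G(P\vee\mathbf X(Q\vee l)))$ and $(\mathbf G(R\vee\mathbf X(\neg l\vee S)))$ derive $(\mathbf G(P\vee R\vee\mathbf X(Q\vee S)))$. (2) Augment: for each eventuality clause $(\mathbf G(P\vee\mathbf F l))\in M$ add $(\mathbf G(P\vee l\vee w_l))$ and, without edge from the premise, $(\mathbf G(\neg w_l\vee\mathbf X(l\vee w_l)))$, where $w_l$ is fresh. Saturate $M$. (3) While $M$ changes, treat each eventuality clause $c=(\mathbf G(Q\vee\mathbf F l))\in C$, in any order, as follows. Put $C'=\{\Box\}$ and iterate: create a new partition $L$ that contains each $(\mathbf G(P\vee\mathbf X R))\in M$ with $R\ne\emptyset$, the clause $(\mathbf G(\mathbf X P))$ for each $(\mathbf G(P))\in M$, and, without edges, $(\mathbf G(\mathbf X(P\vee l)))$ for each $(\mathbf G(P))\in C'$; saturate $L$ under step-xx; let $C''$ be the old $C'$ and let the new $C'$ be the set of clauses with empty $\mathbf X$ part in $L$; for each $(\mathbf G(R))\in C''$ that is subsumed by some clause of $C'$ (i.e.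 contains its literals), add an edge from one such clause to $(\mathbf G(\mathbf X(R\vee l)))$ in $L$. A loop is found if all clauses of $C''$ are subsumed; the iteration stops when a loop is found or $C'=\emptyset$. If a loop is found, add to $M$, for each $(\mathbf G(P))\in C'$, the clause $(\mathbf G(P\vee Q\vee l))$ with edges from $(\mathbf G(P))$ in $L$ and from $c$, and the clause $(\mathbf G(\neg w_l\vee\mathbf X(P\vee l)))$ with an edge only from $(\mathbf G(P))$ in $L$; then saturate $M$. If a pass over all eventuality clauses does not change $M$, return sat. *UC in SNF.* If the procedure returns unsat on $C$, the UC of $C$ in SNF is the set of those $c\in C$ whose vertex in $M$ has a (possibly trivial) path in the resolution graph to a vertex of $M$ labeled with the empty clause $\Box$. *Lifting to LTL.* $\varphi^{uc}$ is obtained from $\varphi$ by replacing each occurrence of a proper subformula $\psi$ of positive (negative) polarity by $1$ (by $0$) iff no clause in $C^{uc}$ is one of the clauses listed above for the immediate superformula occurrence in which $x_\psi$ of that occurrence of $\psi$ appears. -/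

import Mathlib

/-! ## LTL -/

/-- LTL formulas over the atomic propositions `α`. -/
inductive LTL (α : Type*) where
  | tru : LTL α
  | fls : LTL α
  | atom : α → LTL α
  | neg : LTL α → LTL α
  | or : LTL α → LTL α → LTL α
  | and : LTL α → LTL α → LTL α
  | next : LTL α → LTL α
  | untl : LTL α → LTL α → LTL α
  | release : LTL α → LTL α → LTL α
  | eventually : LTL α → LTL α
  | always : LTL α → LTL α

namespace LTL

variable {α : Type*}

/-- `φ.Holds w i`: the formula `φ` holds at time `i` of the infinite word `w`. -/
def Holds (w : ℕ → Set α) : LTL α → ℕ → Prop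
  | tru, _ => True
  | fls, _ => False
  | atom a, i => a ∈ w i
  | neg φ, i => ¬ Holds w φ i
  | or φ ψ, i => Holds w φ i ∨ Holds w ψ i
  | and φ ψ, i => Holds w φ i ∧ Holds w ψ i
  | next φ, i => Holds w φ (i + 1)
  | untl φ ψ, i => ∃ k, i ≤ k ∧ Holds w ψ k ∧ ∀ j, i ≤ j → j < k → Holds w φ j
  | release φ ψ, i => ∀ k, i ≤ k → Holds w ψ k ∨ ∃ j, i ≤ j ∧ j < k ∧ Holds w φ j
  | eventually φ, i => ∃ k, i ≤ k ∧ Holds w φ k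
  | always φ, i => ∀ k, i ≤ k → Holds w φ k

def Satisfiable (φ : LTL α) : Prop := ∃ w : ℕ → Set α, φ.Holds w 0

/-- The Boolean constants `1` and `0`. -/
def ofBool : Bool → LTL α
  | true => tru
  | false => fls

end LTL

/-! ## Separated normal form -/

/-- The propositions that occur in SNF clauses: those of the LTL formula, one fresh proposition
`x` for each occurrence of a non-atomic subformula (an occurrence is given by the path to it
from the root of the syntax tree), and one fresh "wait for" proposition for each literal, where
`wait true p` belongs to the literal `p` and `wait false p` to the literal `¬ p`. -/
inductive SAtom (α : Type*) where
  | ap : α → SAtom α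
  | x : List Bool → SAtom α
  | wait : Bool → SAtom α → SAtom α
  deriving DecidableEq

/-- A literal: `⟨true, p⟩` is `p` and `⟨false, p⟩` is `¬ p`. -/
structure Lit (α : Type*) where
  sign : Bool
  var : SAtom α
  deriving DecidableEq

namespace Lit

variable {α : Type*}

def neg (l : Lit α) : Lit α := ⟨!l.sign, l.var⟩

/-- The positive literal of the "wait for" proposition of `l`. -/
def waitFor (l : Lit α) : Lit α := ⟨true, SAtom.wait l.sign l.var⟩

end Lit

/-- SNF clauses. A finite set of literals stands for its disjunction.
`initial P` is the clause `P`, `global P Q` is `G (P ∨ X Q)`, and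
`eventuality P l` is `G (P ∨ F l)`. -/
inductive Clause (α : Type*) where
  | initial : Finset (Lit α) → Clause α
  | global : Finset (Lit α) → Finset (Lit α) → Clause α
  | eventuality : Finset (Lit α) → Lit α → Clause α
  deriving DecidableEq

namespace Clause

variable {α : Type*}

/-- The empty clause, which is either `0` or `G 0`. -/
def IsEmptyClause (c : Clause α) : Prop := c = initial ∅ ∨ c = global ∅ ∅

def IsEventuality (c : Clause α) : Prop := ∃ P l, c = eventuality P l

end Clause

/-! ## Translation from LTL to SNF

The clauses for an occurrence of a subformula `ψ` are written as schemes over the propositions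
of that occurrence (`self`) and of its immediate subformula occurrences (`fst`, `snd`). -/

inductive Src where
  | self
  | fst
  | snd
  deriving DecidableEq

/-- A literal of a scheme: `(true, s)` is the proposition of `s`, `(false, s)` its negation. -/
abbrev SLit := Bool × Src

/-- `step P Q` is `G (P ∨ X Q)` and `ev P l` is `G (P ∨ F l)`. -/
inductive Scheme where
  | step : List SLit → List SLit → Scheme
  | ev : List SLit → SLit → Scheme

/-- The literals of a scheme. -/
def Scheme.lits : Scheme → List SLit
  | .step P Q => P ++ Q
  | .ev P l => P ++ [l]

/-- What references an occurrence of a subformula in the clauses of its superformula: a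
Boolean value or a proposition. -/
inductive Ref (α : Type*) where
  | const : Bool → Ref α
  | prop : SAtom α → Ref α

section Translation

variable {α : Type*} [DecidableEq α]

/-- The value or proposition itself (`true`) or its negation (`false`). -/
def Ref.signed : Ref α → Bool → Bool ⊕ Lit α
  | .const v, s => Sum.inl (v == s)
  | .prop p, s => Sum.inr ⟨s, p⟩

/-- A disjunction of literals and Boolean constants, simplified: `none` if the constant `1`
is a disjunct, otherwise the set of its literals. -/
def disj : List (Bool ⊕ Lit α) → Option (Finset (Lit α))
  | [] => some ∅
  | Sum.inl true :: _ => none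
  | Sum.inl false :: L => disj L
  | Sum.inr l :: L => (disj L).map (insert l)

/-- The clause given by a scheme when its propositions are given by `env`, after removal of the
Boolean constants; `none` if it is trivially true. -/
def Scheme.inst (env : Src → Ref α) : Scheme → Option (Clause α)
  | .step P Q =>
    match disj (P.map fun l => (env l.2).signed l.1),
        disj (Q.map fun l => (env l.2).signed l.1) with
    | some P', some Q' => some (.global P' Q')
    | _, _ => none
  | .ev P l =>
    match disj (P.map fun l => (env l.2).signed l.1), (env l.2).signed l.1 with
    | none, _ => none
    | some _, Sum.inl true => none
    | some P', Sum.inl false => some (.global P' ∅)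
    | some P', Sum.inr l' => some (.eventuality P' l')

namespace LTL

/-- What references the occurrence of a subformula at position `p`. -/
def ref (p : List Bool) : LTL α → Ref α
  | tru => .const true
  | fls => .const false
  | atom a => .prop (.ap a)
  | _ => .prop (.x p)

/-- What `self`, `fst` and `snd` stand for at the occurrence of a subformula at position `p`. -/
def env (p : List Bool) (ψ : LTL α) : Src → Ref α
  | .self => ψ.ref p
  | .fst =>
    match ψ with
    | neg ψ₁ | next ψ₁ | eventually ψ₁ | always ψ₁ => ψ₁.ref (p ++ [false])
    | or ψ₁ _ | and ψ₁ _ | untl ψ₁ _ | release ψ₁ _ => ψ₁.ref (p ++ [false])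
    | _ => .const true
  | .snd =>
    match ψ with
    | or _ ψ₂ | and _ ψ₂ | untl _ ψ₂ | release _ ψ₂ => ψ₂.ref (p ++ [true])
    | _ => .const true

/-- The translation table. `schemes true ψ` are the clauses for an occurrence of `ψ` of positive
polarity, of the form `G (x → …)`; `schemes false ψ` are those for an occurrence of negative
polarity, of the form `G (¬ x → …)`, where `x` is the proposition of `ψ`. -/
def schemes : Bool → LTL α → List Scheme
  | _, tru | _, fls | _, atom _ => []
  | true, neg _ => [.step [(false, .self), (false, .fst)] []]
  | false, neg _ => [.step [(true, .self), (true, .fst)] []]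
  | true, and _ _ =>
    [.step [(false, .self), (true, .fst)] [], .step [(false, .self), (true, .snd)] []]
  | false, and _ _ => [.step [(true, .self), (false, .fst), (false, .snd)] []]
  | true, or _ _ => [.step [(false, .self), (true, .fst), (true, .snd)] []]
  | false, or _ _ =>
    [.step [(true, .self), (false, .fst)] [], .step [(true, .self), (false, .snd)] []]
  | true, next _ => [.step [(false, .self)] [(true, .fst)]]
  | false, next _ => [.step [(true, .self)] [(false, .fst)]]
  | true, always _ =>
    [.step [(false, .self)] [(true, .self)], .step [(false, .self), (true, .fst)] []]
  | false, always _ => [.ev [(true, .self)] (false, .fst)]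
  | true, eventually _ => [.ev [(false, .self)] (true, .fst)]
  | false, eventually _ =>
    [.step [(true, .self)] [(false, .self)], .step [(true, .self), (false, .fst)] []]
  | true, untl _ _ =>
    [.step [(false, .self), (true, .snd), (true, .fst)] [],
     .step [(false, .self), (true, .snd)] [(true, .self)],
     .ev [(false, .self)] (true, .snd)]
  | false, untl _ _ =>
    [.step [(true, .self), (false, .snd)] [],
     .step [(true, .self), (false, .fst)] [(false, .self)]]
  | true, release _ _ =>
    [.step [(false, .self), (true, .snd)] [],
     .step [(false, .self), (true, .fst)] [(true, .self)]]
  | false, release _ _ =>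
    [.step [(true, .self), (false, .snd), (false, .fst)] [],
     .step [(true, .self), (false, .snd)] [(false, .self)],
     .ev [(true, .self)] (false, .snd)]

/-- The clauses of the occurrence of `ψ` at position `p` with polarity `b`. -/
def nodeClauses (p : List Bool) (b : Bool) (ψ : LTL α) : List (Clause α) :=
  (schemes b ψ).filterMap (Scheme.inst (ψ.env p))

/-- The clauses of the occurrence of a subformula at position `p` with polarity `b`, and of all
occurrences below it. -/
def snfAux (p : List Bool) (b : Bool) : LTL α → List (Clause α)
  | tru | fls | atom _ => []
  | neg ψ => nodeClauses p b (neg ψ) ++ snfAux (p ++ [false]) (!b) ψ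
  | or ψ χ =>
    nodeClauses p b (or ψ χ) ++ snfAux (p ++ [false]) b ψ ++ snfAux (p ++ [true]) b χ
  | and ψ χ =>
    nodeClauses p b (and ψ χ) ++ snfAux (p ++ [false]) b ψ ++ snfAux (p ++ [true]) b χ
  | next ψ => nodeClauses p b (next ψ) ++ snfAux (p ++ [false]) b ψ
  | untl ψ χ =>
    nodeClauses p b (untl ψ χ) ++ snfAux (p ++ [false]) b ψ ++ snfAux (p ++ [true]) b χ
  | release ψ χ =>
    nodeClauses p b (release ψ χ) ++ snfAux (p ++ [false]) b ψ ++ snfAux (p ++ [true]) b χ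
  | eventually ψ => nodeClauses p b (eventually ψ) ++ snfAux (p ++ [false]) b ψ
  | always ψ => nodeClauses p b (always ψ) ++ snfAux (p ++ [false]) b ψ

/-- The SNF of `φ`: the initial clause `x_φ` together with the clauses of all occurrences of
subformulas of `φ`. -/
def snf (φ : LTL α) : Finset (Clause α) :=
  ((disj [(φ.ref []).signed true]).map Clause.initial).toFinset ∪ (snfAux [] true φ).toFinset

/-- Some clause of `C` is one of the clauses of the occurrence of `ψ` at position `p` with
polarity `b` in which the proposition of its immediate subformula occurrence `s` occurs. -/
def Uses (C : Set (Clause α)) (p : List Bool) (b : Bool) (ψ : LTL α) (s : Src) : Prop :=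
  ∃ r ∈ schemes b ψ, (∃ v, (v, s) ∈ r.lits) ∧ ∃ c ∈ C, r.inst (ψ.env p) = some c

open Classical in
/-- The occurrence of a subformula at position `p` with polarity `b`, with those occurrences of
proper subformulas replaced by `1` (positive polarity) or `0` (negative polarity) whose
propositions are not used by the clauses of their immediate superformula that are in `C`. -/
noncomputable def liftAux (C : Set (Clause α)) (p : List Bool) (b : Bool) : LTL α → LTL α
  | tru => tru
  | fls => fls
  | atom a => atom a
  | neg ψ =>
    neg (if Uses C p b (neg ψ) .fst then liftAux C (p ++ [false]) (!b) ψ else ofBool (!b))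
  | or ψ χ =>
    or (if Uses C p b (or ψ χ) .fst then liftAux C (p ++ [false]) b ψ else ofBool b)
      (if Uses C p b (or ψ χ) .snd then liftAux C (p ++ [true]) b χ else ofBool b)
  | and ψ χ =>
    and (if Uses C p b (and ψ χ) .fst then liftAux C (p ++ [false]) b ψ else ofBool b)
      (if Uses C p b (and ψ χ) .snd then liftAux C (p ++ [true]) b χ else ofBool b)
  | next ψ =>
    next (if Uses C p b (next ψ) .fst then liftAux C (p ++ [false]) b ψ else ofBool b)
  | untl ψ χ =>
    untl (if Uses C p b (untl ψ χ) .fst then liftAux C (p ++ [false]) b ψ else ofBool b)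
      (if Uses C p b (untl ψ χ) .snd then liftAux C (p ++ [true]) b χ else ofBool b)
  | release ψ χ =>
    release (if Uses C p b (release ψ χ) .fst then liftAux C (p ++ [false]) b ψ else ofBool b)
      (if Uses C p b (release ψ χ) .snd then liftAux C (p ++ [true]) b χ else ofBool b)
  | eventually ψ =>
    eventually (if Uses C p b (eventually ψ) .fst then liftAux C (p ++ [false]) b ψ else ofBool b)
  | always ψ =>
    always (if Uses C p b (always ψ) .fst then liftAux C (p ++ [false]) b ψ else ofBool b)

/-- The formula obtained by lifting a set `C` of clauses of the SNF of `φ` back to LTL. -/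
noncomputable def lift (C : Set (Clause α)) (φ : LTL α) : LTL α := liftAux C [] true φ

end LTL

end Translation

/-! ## Temporal resolution and its resolution graph -/

/-- A vertex is given by its partition (`none` for the main partition, `some i` for the
partition of the `i`-th loop search iteration) and the clause that it is labeled with; no
partition has two vertices with the same clause. -/
abbrev Vertex (α : Type*) := Option ℕ × Clause α

/-- A resolution graph under construction; `loops` is the number of loop search iterations
entered so far. -/
structure ResGraph (α : Type*) where
  verts : Set (Vertex α)
  edges : Set (Vertex α × Vertex α)
  loops : ℕ

namespace ResGraph

variable {α : Type*}

/-- The initial resolution graph for the set of starting clauses `C`. -/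
def start (C : Finset (Clause α)) : ResGraph α where
  verts := {v | v.1 = none ∧ v.2 ∈ C}
  edges := ∅
  loops := 0

/-- The clauses in a partition. -/
def part (G : ResGraph α) (k : Option ℕ) : Set (Clause α) := {c | (k, c) ∈ G.verts}

/-- The clauses in the main partition. -/
def main (G : ResGraph α) : Set (Clause α) := G.part none

/-- `G` with a new vertex for the clause `c` in partition `k` and edges from `S` to it. -/
def add (G : ResGraph α) (k : Option ℕ) (c : Clause α) (S : Set (Vertex α)) : ResGraph α where
  verts := insert (k, c) G.verts
  edges := G.edges ∪ {e | e.1 ∈ S ∧ e.2 = (k, c)}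
  loops := G.loops

/-- A new partition is created. -/
def newLoop (G : ResGraph α) : ResGraph α := { G with loops := G.loops + 1 }

def addEdges (G : ResGraph α) (S : Set (Vertex α × Vertex α)) : ResGraph α :=
  { G with edges := G.edges ∪ S }

/-- The disjunctions `P` such that `G (P)` is a global clause with empty `X` part in `k`. -/
def emptyX (G : ResGraph α) (k : Option ℕ) : Set (Finset (Lit α)) :=
  {P | Clause.global P ∅ ∈ G.part k}

def HasEmptyClause (G : ResGraph α) : Prop := ∃ c ∈ G.main, c.IsEmptyClause

/-- The unsatisfiable core in SNF: the starting clauses that label vertices of the main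
partition from which `v` can be reached. -/
def core (G : ResGraph α) (C : Finset (Clause α)) (v : Vertex α) : Set (Clause α) :=
  {c | c ∈ C ∧ (none, c) ∈ G.verts ∧
    Relation.ReflTransGen (fun u u' => (u, u') ∈ G.edges) (none, c) v}

end ResGraph

section TemporalResolution

variable {α : Type*} [DecidableEq α]

/-- `StepXX c₁ c₂ c`: rule step-xx derives `c` from `c₁` and `c₂`. -/
inductive StepXX : Clause α → Clause α → Clause α → Prop
  | mk (P Q R S : Finset (Lit α)) (l : Lit α) (h : l ∈ Q) (h' : l.neg ∈ S) :
    StepXX (.global P Q) (.global R S) (.global (P ∪ R) (Q.erase l ∪ S.erase l.neg))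

/-- The saturation rules. -/
inductive SatRule : Clause α → Clause α → Clause α → Prop
  | init_ii (P Q : Finset (Lit α)) (l : Lit α) (h : l ∈ P) (h' : l.neg ∈ Q) :
    SatRule (.initial P) (.initial Q) (.initial (P.erase l ∪ Q.erase l.neg))
  | init_in (P Q : Finset (Lit α)) (l : Lit α) (h : l ∈ P) (h' : l.neg ∈ Q) :
    SatRule (.initial P) (.global Q ∅) (.initial (P.erase l ∪ Q.erase l.neg))
  | step_nn (P Q : Finset (Lit α)) (l : Lit α) (h : l ∈ P) (h' : l.neg ∈ Q) :
    SatRule (.global P ∅) (.global Q ∅) (.global (P.erase l ∪ Q.erase l.neg) ∅)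
  | step_nx (P Q R : Finset (Lit α)) (l : Lit α) (h : l ∈ P) (h' : l.neg ∈ R) :
    SatRule (.global P ∅) (.global Q R) (.global Q (P.erase l ∪ R.erase l.neg))
  | step_xx (c₁ c₂ c : Clause α) (h : StepXX c₁ c₂ c) : SatRule c₁ c₂ c

/-- Application of a saturation rule in the main partition that generates a new clause. -/
def SatStep (G G' : ResGraph α) : Prop :=
  ∃ c₁ ∈ G.main, ∃ c₂ ∈ G.main, ∃ c, SatRule c₁ c₂ c ∧ c ∉ G.main ∧
    G' = G.add none c {(none, c₁), (none, c₂)}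

/-- Application of rule aug1 or aug2 that generates a new clause. For aug2, there is no edge
from the premise. -/
inductive AugStep (G : ResGraph α) : ResGraph α → Prop
  | aug1 (P : Finset (Lit α)) (l : Lit α) (h : .eventuality P l ∈ G.main)
    (hnew : .global (P ∪ {l, l.waitFor}) ∅ ∉ G.main) :
    AugStep G (G.add none (.global (P ∪ {l, l.waitFor}) ∅) {(none, .eventuality P l)})
  | aug2 (P : Finset (Lit α)) (l : Lit α) (h : .eventuality P l ∈ G.main)
    (hnew : .global {l.waitFor.neg} {l, l.waitFor} ∉ G.main) :
    AugStep G (G.add none (.global {l.waitFor.neg} {l, l.waitFor}) ∅)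

/-- Application of a rule that initializes the loop search iteration with partition `i` for the
eventuality literal `l`, and that generates a new clause. `C'` are the disjunctions of the global
clauses with empty `X` part from the previous iteration. For BFS-loop-it-init-c, there are no
edges from the premises. -/
inductive LoopInitStep (C' : Set (Finset (Lit α))) (l : Lit α) (i : ℕ) (G : ResGraph α) :
    ResGraph α → Prop
  | init_x (P Q : Finset (Lit α)) (h : .global P Q ∈ G.main) (hQ : Q.Nonempty)
    (hnew : .global P Q ∉ G.part (some i)) :
    LoopInitStep C' l i G (G.add (some i) (.global P Q) {(none, .global P Q)})
  | init_n (P : Finset (Lit α)) (h : .global P ∅ ∈ G.main)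
    (hnew : .global ∅ P ∉ G.part (some i)) :
    LoopInitStep C' l i G (G.add (some i) (.global ∅ P) {(none, .global P ∅)})
  | init_c (P : Finset (Lit α)) (h : P ∈ C')
    (hnew : .global ∅ (insert l P) ∉ G.part (some i)) :
    LoopInitStep C' l i G (G.add (some i) (.global ∅ (insert l P)) ∅)

/-- Application of rule step-xx in partition `i` that generates a new clause. -/
def LoopSatStep (i : ℕ) (G G' : ResGraph α) : Prop :=
  ∃ c₁ ∈ G.part (some i), ∃ c₂ ∈ G.part (some i), ∃ c, StepXX c₁ c₂ c ∧
    c ∉ G.part (some i) ∧ G' = G.add (some i) c {(some i, c₁), (some i, c₂)}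

/-- Application of rule BFS-loop-conclusion1 or BFS-loop-conclusion2 to a clause in partition `i`
and the eventuality clause `G (Q ∨ F l)` that generates a new clause. For
BFS-loop-conclusion2, there is no edge from the eventuality clause. -/
inductive LoopConclStep (Q : Finset (Lit α)) (l : Lit α) (i : ℕ) (G : ResGraph α) :
    ResGraph α → Prop
  | concl1 (P : Finset (Lit α)) (h : P ∈ G.emptyX (some i))
    (hnew : .global (P ∪ Q ∪ {l}) ∅ ∉ G.main) :
    LoopConclStep Q l i G (G.add none (.global (P ∪ Q ∪ {l}) ∅)
      {(some i, .global P ∅), (none, .eventuality Q l)})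
  | concl2 (P : Finset (Lit α)) (h : P ∈ G.emptyX (some i))
    (hnew : .global {l.waitFor.neg} (insert l P) ∉ G.main) :
    LoopConclStep Q l i G (G.add none (.global {l.waitFor.neg} (insert l P))
      {(some i, .global P ∅)})

/-- Steps are performed, in any order, until none is possible. -/
def Exhaust (step : ResGraph α → ResGraph α → Prop) (G G' : ResGraph α) : Prop :=
  Relation.ReflTransGen step G G' ∧ ∀ G'', ¬ step G' G''

/-- `P ∈ C'` subsumes `Q` if its literals are among those of `Q`. -/
def Subsumes (C' C'' : Set (Finset (Lit α))) : Prop := ∀ Q ∈ C'', ∃ P ∈ C', P ⊆ Q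

/-- The recorded applications of rule BFS-loop-it-sub: `(P, Q) ∈ D` if `P ∈ C'` is the first
clause that was found to subsume `Q ∈ C''`. -/
structure IsSubRecord (C' C'' : Set (Finset (Lit α)))
    (D : Set (Finset (Lit α) × Finset (Lit α))) : Prop where
  valid : ∀ P Q, (P, Q) ∈ D → P ∈ C' ∧ Q ∈ C'' ∧ P ⊆ Q
  unique : ∀ P P' Q, (P, Q) ∈ D → (P', Q) ∈ D → P = P'
  total : ∀ Q ∈ C'', (∃ P ∈ C', P ⊆ Q) → ∃ P, (P, Q) ∈ D

/-- One loop search iteration for the eventuality literal `l` with the set `C''` of clauses from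
the previous iteration, from `G` to `G'`. The new partition is `some G.loops`. -/
def LoopIteration (l : Lit α) (C'' : Set (Finset (Lit α))) (G G' : ResGraph α) : Prop :=
  ∃ G₁ G₂ D, Exhaust (LoopInitStep C'' l G.loops) G.newLoop G₁ ∧
    Exhaust (LoopSatStep G.loops) G₁ G₂ ∧
    IsSubRecord (G₂.emptyX (some G.loops)) C'' D ∧
    G' = G₂.addEdges {e | ∃ P Q, (P, Q) ∈ D ∧
      e = ((some G.loops, .global P ∅), (some G.loops, .global ∅ (insert l Q)))}

/-- `LoopSearch l C'' G r G'`: the repeat loop of a loop search for the eventuality literal `l`,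
entered with the set of clauses `C''`, leads from `G` to `G'`; `r` is the partition of the last
iteration if a loop has been found, and `none` otherwise. -/
inductive LoopSearch (l : Lit α) :
    Set (Finset (Lit α)) → ResGraph α → Option ℕ → ResGraph α → Prop
  | found (C'' : Set (Finset (Lit α))) (G G' : ResGraph α) (h : LoopIteration l C'' G G')
    (hs : Subsumes (G'.emptyX (some G.loops)) C'') : LoopSearch l C'' G (some G.loops) G'
  | notFound (C'' : Set (Finset (Lit α))) (G G' : ResGraph α) (h : LoopIteration l C'' G G')
    (hs : ¬ Subsumes (G'.emptyX (some G.loops)) C'') (he : G'.emptyX (some G.loops) = ∅) :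
    LoopSearch l C'' G none G'
  | again (C'' : Set (Finset (Lit α))) (G G' G'' : ResGraph α) (r : Option ℕ)
    (h : LoopIteration l C'' G G') (hs : ¬ Subsumes (G'.emptyX (some G.loops)) C'')
    (he : G'.emptyX (some G.loops) ≠ ∅)
    (hr : LoopSearch l (G'.emptyX (some G.loops)) G' r G'') : LoopSearch l C'' G r G''

inductive Outcome where
  | unsat
  | sat

/-- The for loop over the list of eventuality clauses still to be treated; the outcome is `none`
if it ends without returning. -/
inductive ForLoop : List (Clause α) → ResGraph α → Option Outcome → ResGraph α → Prop
  | done (G : ResGraph α) : ForLoop [] G none G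
  | notFound (Q : Finset (Lit α)) (l : Lit α) (L : List (Clause α)) (G G₁ G' : ResGraph α)
    (r : Option Outcome) (hl : LoopSearch l {∅} G none G₁) (hr : ForLoop L G₁ r G') :
    ForLoop (.eventuality Q l :: L) G r G'
  | foundUnsat (Q : Finset (Lit α)) (l : Lit α) (L : List (Clause α)) (i : ℕ)
    (G G₁ G₂ G' : ResGraph α) (hl : LoopSearch l {∅} G (some i) G₁)
    (hc : Exhaust (LoopConclStep Q l i) G₁ G₂) (hs : Exhaust SatStep G₂ G')
    (he : G'.HasEmptyClause) : ForLoop (.eventuality Q l :: L) G (some .unsat) G'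
  | foundContinue (Q : Finset (Lit α)) (l : Lit α) (L : List (Clause α)) (i : ℕ)
    (G G₁ G₂ G₃ G' : ResGraph α) (r : Option Outcome) (hl : LoopSearch l {∅} G (some i) G₁)
    (hc : Exhaust (LoopConclStep Q l i) G₁ G₂) (hs : Exhaust SatStep G₂ G₃)
    (he : ¬ G₃.HasEmptyClause) (hr : ForLoop L G₃ r G') :
    ForLoop (.eventuality Q l :: L) G r G'

/-- The while loop, where `M'` is the main partition at the previous test. -/
inductive WhileLoop (C : Finset (Clause α)) :
    Set (Clause α) → ResGraph α → Outcome → ResGraph α → Prop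
  | exit (M' : Set (Clause α)) (G : ResGraph α) (h : M' = G.main) : WhileLoop C M' G .sat G
  | ret (M' : Set (Clause α)) (G G' : ResGraph α) (L : List (Clause α)) (r : Outcome)
    (h : M' ≠ G.main) (hn : L.Nodup) (hL : ∀ c, c ∈ L ↔ c ∈ C ∧ c.IsEventuality)
    (hf : ForLoop L G (some r) G') : WhileLoop C M' G r G'
  | again (M' : Set (Clause α)) (G G₁ G' : ResGraph α) (L : List (Clause α)) (r : Outcome)
    (h : M' ≠ G.main) (hn : L.Nodup) (hL : ∀ c, c ∈ L ↔ c ∈ C ∧ c.IsEventuality)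
    (hf : ForLoop L G none G₁) (hr : WhileLoop C G.main G₁ r G') : WhileLoop C M' G r G'

/-- `TRRun C r G`: an execution of temporal resolution on the set of SNF clauses `C` terminates
with outcome `r` and with the resolution graph `G`. -/
inductive TRRun (C : Finset (Clause α)) : Outcome → ResGraph α → Prop
  | unsat₀ (h : (ResGraph.start C).HasEmptyClause) : TRRun C .unsat (ResGraph.start C)
  | unsat₁ (G : ResGraph α) (h₀ : ¬ (ResGraph.start C).HasEmptyClause)
    (h₁ : Exhaust SatStep (ResGraph.start C) G) (h : G.HasEmptyClause) : TRRun C .unsat G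
  | unsat₂ (G₁ G₂ G : ResGraph α) (h₀ : ¬ (ResGraph.start C).HasEmptyClause)
    (h₁ : Exhaust SatStep (ResGraph.start C) G₁) (he : ¬ G₁.HasEmptyClause)
    (h₂ : Exhaust AugStep G₁ G₂) (h₃ : Exhaust SatStep G₂ G) (h : G.HasEmptyClause) :
    TRRun C .unsat G
  | main (G₁ G₂ G₃ G : ResGraph α) (r : Outcome) (h₀ : ¬ (ResGraph.start C).HasEmptyClause)
    (h₁ : Exhaust SatStep (ResGraph.start C) G₁) (he₁ : ¬ G₁.HasEmptyClause)
    (h₂ : Exhaust AugStep G₁ G₂) (h₃ : Exhaust SatStep G₂ G₃) (he₃ : ¬ G₃.HasEmptyClause)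
    (h : WhileLoop C ∅ G₃ r G) : TRRun C r G

/-- `C'` is an unsatisfiable core in SNF of `C`, obtained from an execution of temporal resolution
on `C` that shows unsatisfiability by backward traversal of the resolution graph from a vertex
of the main partition that is labeled with the empty clause. -/
def IsCoreInSNF (C : Finset (Clause α)) (C' : Set (Clause α)) : Prop :=
  ∃ G : ResGraph α, TRRun C .unsat G ∧
    ∃ c, (none, c) ∈ G.verts ∧ c.IsEmptyClause ∧ C' = G.core C (none, c)

/-- `φ'` is an unsatisfiable core in LTL of `φ`. -/
def IsCoreInLTL (φ φ' : LTL α) : Prop :=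
  ∃ C' : Set (Clause α), IsCoreInSNF φ.snf C' ∧ φ' = φ.lift C'

end TemporalResolution

/-! The proof is semantic and concerns one interpretation `v` at a time. From a model `w` of the
lifted formula one builds `LTL.coreInterp`, which satisfies every clause of the core; soundness of
the derivation restricted to the core then makes the empty clause true, a contradiction.

Soundness (`TRRun.sound`). Let `A` be the set of vertices with a path to the chosen empty clause. It
contains the sources of all edges into it, so starting clauses in `A` are core clauses, and every
main clause in `A` inherits validity from premises in `A`. What needs an argument are the rules with
missing edges. Reading each proposition `w_l` as `X F l` makes the second augmentation clause a
tautology and spares the second loop conclusion its eventuality premise. The clauses `G (X (R ∨ l))`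
that start a loop search iteration have no justification at all. In that partition one therefore
proves only conditional truth (`ResGraph.LoopSound`): a clause in `A` that fails at `t` can be
blamed on some such start clause in `A` with `R ∨ l` false at `t + 1`. When a loop is found, the
subsumption edge puts some `P' ⊆ R` into `A`; `P'` is false at `t + 1`, and the argument repeats
from there. Hence `l` is false at all later times, which is what the conclusions need
(`LoopIteration.sound`).

Lifting (`LTL.valid_of_mem_snf`). Interpret the proposition of each occurrence by the truth of its
lifted version over `w`. The translation clauses express one direction of the semantics of the
connectives and hold whatever the subformulas are. A core clause mentioning a subformula is itself
the reason why that subformula is not replaced, so its proposition agrees with the formula standing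
in its place (`LTL.liftInterp_eq`). -/

/-! ## Semantics of SNF clauses -/

section Semantics

variable {α : Type*}

/-- The literal `l` holds at time `t` of the interpretation `v`. -/
def Lit.Holds (v : ℕ → SAtom α → Prop) (t : ℕ) (l : Lit α) : Prop :=
  v t l.var ↔ l.sign = true

/-- Some literal of `P` holds at time `t`. -/
def DisjHolds (v : ℕ → SAtom α → Prop) (t : ℕ) (P : Finset (Lit α)) : Prop :=
  ∃ l ∈ P, l.Holds v t

/-- The instance of a clause at time `t`; initial clauses only speak about time `0`. -/
def Clause.HoldsAt (v : ℕ → SAtom α → Prop) (t : ℕ) : Clause α → Prop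
  | .initial P => DisjHolds v 0 P
  | .global P Q => DisjHolds v t P ∨ DisjHolds v (t + 1) Q
  | .eventuality P l => DisjHolds v t P ∨ ∃ k, t ≤ k ∧ l.Holds v k

def Clause.Valid (v : ℕ → SAtom α → Prop) (c : Clause α) : Prop := ∀ t, c.HoldsAt v t

/-- The "wait for" proposition of each literal `l` is interpreted as `X F l`. -/
def InterpretsWait (v : ℕ → SAtom α → Prop) : Prop :=
  ∀ t s p, v t (.wait s p) ↔ ∃ k, t < k ∧ (v k p ↔ s = true)

variable {v : ℕ → SAtom α → Prop} {t : ℕ} {l : Lit α} {P Q : Finset (Lit α)}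

theorem Lit.holds_neg : l.neg.Holds v t ↔ ¬ l.Holds v t := by
  rcases l with ⟨s, p⟩
  cases s <;> simp [Lit.neg, Lit.Holds]

theorem Lit.holds_waitFor (hv : InterpretsWait v) :
    l.waitFor.Holds v t ↔ ∃ k, t < k ∧ l.Holds v k := by
  simp [Lit.waitFor, Lit.Holds, hv t l.sign l.var]

theorem DisjHolds.mono (h : DisjHolds v t P) (hPQ : P ⊆ Q) : DisjHolds v t Q :=
  let ⟨l, hl, h⟩ := h
  ⟨l, hPQ hl, h⟩

@[simp]
theorem not_disjHolds_empty : ¬ DisjHolds v t ∅ := by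
  simp [DisjHolds]

theorem disjHolds_singleton : DisjHolds v t {l} ↔ l.Holds v t := by
  simp [DisjHolds]

theorem Clause.IsEmptyClause.not_valid {c : Clause α} (hc : c.IsEmptyClause) : ¬ c.Valid v := by
  intro h
  rcases hc with rfl | rfl
  · exact not_disjHolds_empty (h 0)
  · exact (h 0).elim not_disjHolds_empty not_disjHolds_empty

variable [DecidableEq α]

theorem disjHolds_union : DisjHolds v t (P ∪ Q) ↔ DisjHolds v t P ∨ DisjHolds v t Q := by
  simp only [DisjHolds, Finset.mem_union, or_and_right, exists_or]

theorem disjHolds_insert : DisjHolds v t (insert l P) ↔ l.Holds v t ∨ DisjHolds v t P := by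
  simp [DisjHolds]

/-- The two true literals cannot both be pivots. Membership of the pivots is not needed, as erasing
an absent literal changes nothing. -/
theorem DisjHolds.resolvent (hP : DisjHolds v t P) (hQ : DisjHolds v t Q) (l : Lit α) :
    DisjHolds v t (P.erase l ∪ Q.erase l.neg) := by
  obtain ⟨a, ha, hva⟩ := hP
  obtain ⟨b, hb, hvb⟩ := hQ
  by_cases hal : a = l
  · by_cases hbl : b = l.neg
    · subst hal hbl
      exact absurd hva (Lit.holds_neg.1 hvb)
    · exact ⟨b, by simp [hb, hbl], hvb⟩
  · exact ⟨a, by simp [ha, hal], hva⟩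

/-- Both premises are used at the same time as the conclusion. This pointwise form is essential in
loop search partitions, whose clauses need not be valid. -/
theorem StepXX.holdsAt {c₁ c₂ c : Clause α} (h : StepXX c₁ c₂ c) (h₁ : c₁.HoldsAt v t)
    (h₂ : c₂.HoldsAt v t) : c.HoldsAt v t := by
  obtain ⟨P, Q, R, S, l, -, -⟩ := h
  simp only [Clause.HoldsAt, disjHolds_union (P := P)] at h₁ h₂ ⊢
  rcases h₁ with h₁ | h₁
  · exact .inl (.inl h₁)
  rcases h₂ with h₂ | h₂
  · exact .inl (.inr h₂)
  · exact .inr (h₁.resolvent h₂ l)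

/-- Validity at all times is required here: `step_nx` reads its first premise at `t + 1`, and
`init_in` reads its second at `0`. -/
theorem SatRule.valid {c₁ c₂ c : Clause α} (h : SatRule c₁ c₂ c) (h₁ : c₁.Valid v)
    (h₂ : c₂.Valid v) : c.Valid v := by
  intro t
  cases h with
  | init_ii P Q l => exact (h₁ t).resolvent (h₂ t) l
  | init_in P Q l => exact (h₁ t).resolvent ((h₂ 0).resolve_right not_disjHolds_empty) l
  | step_nn P Q l =>
    exact .inl (((h₁ t).resolve_right not_disjHolds_empty).resolvent
      ((h₂ t).resolve_right not_disjHolds_empty) l)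
  | step_nx P Q R l =>
    exact (h₂ t).imp_right fun h₂ =>
      ((h₁ (t + 1)).resolve_right not_disjHolds_empty).resolvent h₂ l
  | step_xx _ _ _ h => exact h.holdsAt (h₁ t) (h₂ t)

end Semantics

/-! ## Growth of the resolution graph -/

section Growth

variable {α : Type*}

structure ResGraph.Extends (G' G : ResGraph α) : Prop where
  verts : G.verts ⊆ G'.verts
  edges : G.edges ⊆ G'.edges

theorem ResGraph.Extends.refl (G : ResGraph α) : G.Extends G := ⟨subset_rfl, subset_rfl⟩

theorem ResGraph.Extends.trans {G G' G'' : ResGraph α} (h : G'.Extends G) (h' : G''.Extends G') :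
    G''.Extends G :=
  ⟨h.verts.trans h'.verts, h.edges.trans h'.edges⟩

theorem ResGraph.extends_add (G : ResGraph α) (k : Option ℕ) (c : Clause α)
    (S : Set (Vertex α)) : (G.add k c S).Extends G :=
  ⟨Set.subset_insert _ _, Set.subset_union_left⟩

/-- The set of vertices `A` contains the sources of all edges of `G` into it. -/
def ResGraph.Closed (G : ResGraph α) (A : Set (Vertex α)) : Prop :=
  ∀ u u', (u, u') ∈ G.edges → u' ∈ A → u ∈ A

/-- Closure is known for the final graph, which also has the edges added last. It passes backwards
to every intermediate graph, while soundness passes forwards. -/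
theorem ResGraph.Closed.of_extends {G G' : ResGraph α} {A : Set (Vertex α)} (hA : G'.Closed A)
    (h : G'.Extends G) : G.Closed A :=
  fun u u' he => hA u u' (h.edges he)

theorem ResGraph.Closed.mem_of_add {G : ResGraph α} {A : Set (Vertex α)} {k : Option ℕ}
    {c : Clause α} {S : Set (Vertex α)} (hA : (G.add k c S).Closed A) (hc : (k, c) ∈ A)
    {u : Vertex α} (hu : u ∈ S) : u ∈ A :=
  hA u _ (.inr ⟨hu, rfl⟩) hc

theorem reflTransGen_extends {step : ResGraph α → ResGraph α → Prop}
    (hstep : ∀ G G', step G G' → G'.Extends G) {G G' : ResGraph α}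
    (h : Relation.ReflTransGen step G G') : G'.Extends G := by
  induction h with
  | refl => exact .refl _
  | tail _ h ih => exact ih.trans (hstep _ _ h)

/-- An invariant of single steps, relative to a closed set of vertices, is one of their
iteration. -/
theorem reflTransGen_invariant {step : ResGraph α → ResGraph α → Prop}
    {A : Set (Vertex α)} {I : ResGraph α → Prop} (hext : ∀ G G', step G G' → G'.Extends G)
    (hstep : ∀ G G', step G G' → G'.Closed A → I G → I G') {G G' : ResGraph α}
    (h : Relation.ReflTransGen step G G') (hA : G'.Closed A) (hI : I G) : I G' := by
  induction h with
  | refl => exact hI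
  | tail _ h ih => exact hstep _ _ h hA (ih (hA.of_extends (hext _ _ h)))

/-! ### Monotonicity of each phase of the procedure. -/

variable [DecidableEq α] {G G' : ResGraph α}

theorem SatStep.extends (h : SatStep G G') : G'.Extends G := by
  obtain ⟨_, _, _, _, _, _, _, rfl⟩ := h
  exact G.extends_add _ _ _

theorem AugStep.extends (h : AugStep G G') : G'.Extends G := by
  cases h <;> exact G.extends_add _ _ _

theorem LoopInitStep.extends {C' : Set (Finset (Lit α))} {l : Lit α} {i : ℕ}
    (h : LoopInitStep C' l i G G') : G'.Extends G := by
  cases h <;> exact G.extends_add _ _ _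

theorem LoopSatStep.extends {i : ℕ} (h : LoopSatStep i G G') : G'.Extends G := by
  obtain ⟨_, _, _, _, _, _, _, rfl⟩ := h
  exact G.extends_add _ _ _

theorem LoopConclStep.extends {Q : Finset (Lit α)} {l : Lit α} {i : ℕ}
    (h : LoopConclStep Q l i G G') : G'.Extends G := by
  cases h <;> exact G.extends_add _ _ _

theorem LoopIteration.extends {l : Lit α} {C'' : Set (Finset (Lit α))}
    (h : LoopIteration l C'' G G') : G'.Extends G := by
  obtain ⟨G₁, G₂, D, h₁, h₂, -, rfl⟩ := h
  have h₀ : G.newLoop.Extends G := ⟨subset_rfl, subset_rfl⟩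
  have h₃ : G₂.Extends G := (h₀.trans (reflTransGen_extends (fun _ _ h => h.extends) h₁.1)).trans
    (reflTransGen_extends (fun _ _ h => h.extends) h₂.1)
  exact h₃.trans ⟨subset_rfl, Set.subset_union_left⟩

theorem LoopSearch.extends {l : Lit α} {C'' : Set (Finset (Lit α))} {r : Option ℕ}
    (h : LoopSearch l C'' G r G') : G'.Extends G := by
  induction h with
  | found _ _ _ h => exact h.extends
  | notFound _ _ _ h => exact h.extends
  | again _ _ _ _ _ h _ _ _ ih => exact h.extends.trans ih

theorem exhaust_satStep_extends (h : Exhaust SatStep G G') : G'.Extends G :=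
  reflTransGen_extends (fun _ _ h => h.extends) h.1

theorem exhaust_augStep_extends (h : Exhaust AugStep G G') : G'.Extends G :=
  reflTransGen_extends (fun _ _ h => h.extends) h.1

theorem exhaust_loopConclStep_extends {Q : Finset (Lit α)} {l : Lit α} {i : ℕ}
    (h : Exhaust (LoopConclStep Q l i) G G') : G'.Extends G :=
  reflTransGen_extends (fun _ _ h => h.extends) h.1

theorem ForLoop.extends {L : List (Clause α)} {r : Option Outcome} (h : ForLoop L G r G') :
    G'.Extends G := by
  induction h with
  | done G => exact .refl G
  | notFound _ _ _ _ _ _ _ hl _ ih => exact hl.extends.trans ih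
  | foundUnsat _ _ _ _ _ _ _ _ hl hc hs =>
    exact (hl.extends.trans (exhaust_loopConclStep_extends hc)).trans (exhaust_satStep_extends hs)
  | foundContinue _ _ _ _ _ _ _ _ _ _ hl hc hs _ _ ih =>
    exact ((hl.extends.trans (exhaust_loopConclStep_extends hc)).trans
      (exhaust_satStep_extends hs)).trans ih

theorem WhileLoop.extends {C : Finset (Clause α)} {M' : Set (Clause α)} {r : Outcome}
    (h : WhileLoop C M' G r G') : G'.Extends G := by
  induction h with
  | exit _ G => exact .refl G
  | ret _ _ _ _ _ _ _ _ hf => exact hf.extends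
  | again _ _ _ _ _ _ _ _ _ hf _ ih => exact hf.extends.trans ih

theorem TRRun.extends {C : Finset (Clause α)} {r : Outcome} (h : TRRun C r G) :
    G.Extends (ResGraph.start C) := by
  cases h with
  | unsat₀ => exact .refl _
  | unsat₁ _ _ h₁ => exact exhaust_satStep_extends h₁
  | unsat₂ _ _ _ _ h₁ _ h₂ h₃ =>
    exact ((exhaust_satStep_extends h₁).trans (exhaust_augStep_extends h₂)).trans
      (exhaust_satStep_extends h₃)
  | main _ _ _ _ _ _ h₁ _ h₂ h₃ _ h =>
    exact (((exhaust_satStep_extends h₁).trans (exhaust_augStep_extends h₂)).trans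
      (exhaust_satStep_extends h₃)).trans h.extends

end Growth

/-! ## Soundness of temporal resolution relative to a closed set of vertices -/

section Soundness

variable {α : Type*}

/-- The clauses of the main partition whose vertices are in `A` are valid, and the loop search
partitions are those with an index below `G.loops`. -/
structure ResGraph.Sound (G : ResGraph α) (v : ℕ → SAtom α → Prop) (A : Set (Vertex α)) :
    Prop where
  valid : ∀ c, (none, c) ∈ G.verts → (none, c) ∈ A → c.Valid v
  bound : ∀ i c, (some i, c) ∈ G.verts → i < G.loops

variable {v : ℕ → SAtom α → Prop} {A : Set (Vertex α)} {G G' : ResGraph α}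

theorem ResGraph.Sound.add_main (hG : G.Sound v A) {c : Clause α} {S : Set (Vertex α)}
    (hc : (none, c) ∈ A → c.Valid v) : (G.add none c S).Sound v A where
  valid c' hc' hA := by
    rcases hc' with h | h
    · obtain rfl : c' = c := congrArg Prod.snd h
      exact hc hA
    · exact hG.valid c' h hA
  bound i c' hc' := by
    rcases hc' with h | h
    · cases congrArg Prod.fst h
    · exact hG.bound i c' h

theorem ResGraph.Sound.add_loop (hG : G.Sound v A) {i : ℕ} (hi : i < G.loops) {c : Clause α}
    {S : Set (Vertex α)} : (G.add (some i) c S).Sound v A where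
  valid c' hc' hA := by
    rcases hc' with h | h
    · cases congrArg Prod.fst h
    · exact hG.valid c' h hA
  bound j c' hc' := by
    rcases hc' with h | h
    · obtain rfl : j = i := Option.some.inj (congrArg Prod.fst h)
      exact hi
    · exact hG.bound j c' h

variable [DecidableEq α]

theorem SatStep.sound (h : SatStep G G') (hA : G'.Closed A) (hG : G.Sound v A) :
    G'.Sound v A := by
  obtain ⟨c₁, h₁, c₂, h₂, c, hc, -, rfl⟩ := h
  exact hG.add_main fun hcA => hc.valid (hG.valid c₁ h₁ (hA.mem_of_add hcA (by simp)))
    (hG.valid c₂ h₂ (hA.mem_of_add hcA (by simp)))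

theorem exhaust_satStep_sound (h : Exhaust SatStep G G') (hA : G'.Closed A)
    (hG : G.Sound v A) : G'.Sound v A :=
  reflTransGen_invariant (I := fun G => G.Sound v A) (fun _ _ h => h.extends)
    (fun _ _ h => h.sound) h.1 hA hG

/-- Both rules come from `F l ↔ l ∨ X F l`, with `w_l` read as `X F l`. For `aug2` this alone
suffices, so the absent edge does no harm. -/
theorem AugStep.sound (hv : InterpretsWait v) (h : AugStep G G') (hA : G'.Closed A)
    (hG : G.Sound v A) : G'.Sound v A := by
  cases h with
  | aug1 P l h =>
    refine hG.add_main fun hcA t => .inl ?_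
    have hP := hG.valid _ h (hA.mem_of_add hcA (by simp)) t
    simp only [disjHolds_union, disjHolds_insert, disjHolds_singleton, Lit.holds_waitFor hv]
    rcases hP with hP | ⟨k, hk, hl⟩
    · exact .inl hP
    · rcases hk.eq_or_lt with rfl | hk
      · exact .inr (.inl hl)
      · exact .inr (.inr ⟨k, hk, hl⟩)
  | aug2 P l h =>
    refine hG.add_main fun _ t => ?_
    simp only [Clause.HoldsAt, disjHolds_insert, disjHolds_singleton, Lit.holds_neg,
      Lit.holds_waitFor hv]
    by_cases hw : ∃ k, t < k ∧ l.Holds v k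
    · obtain ⟨k, hk, hl⟩ := hw
      rcases (Nat.succ_le_of_lt hk).eq_or_lt with rfl | hk
      · exact .inr (.inl hl)
      · exact .inr (.inr ⟨k, hk, hl⟩)
    · exact .inl hw

theorem exhaust_augStep_sound (hv : InterpretsWait v) (h : Exhaust AugStep G G')
    (hA : G'.Closed A) (hG : G.Sound v A) : G'.Sound v A :=
  reflTransGen_invariant (I := fun G => G.Sound v A) (fun _ _ h => h.extends)
    (fun _ _ h => h.sound hv) h.1 hA hG

/-- Soundness during an iteration of the loop search: a clause of partition `i` in `A` can be
violated at time `t` only if a clause `G (X (R ∨ l))` in `A` that stems from `C''` is. -/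
structure ResGraph.LoopSound (G : ResGraph α) (v : ℕ → SAtom α → Prop) (A : Set (Vertex α))
    (C'' : Set (Finset (Lit α))) (l : Lit α) (i : ℕ) : Prop where
  sound : G.Sound v A
  lt : i < G.loops
  holdsAt : ∀ c, (some i, c) ∈ G.verts → (some i, c) ∈ A → ∀ t, c.HoldsAt v t ∨
    ∃ R ∈ C'', (some i, .global ∅ (insert l R)) ∈ A ∧ ¬ DisjHolds v (t + 1) (insert l R)

theorem ResGraph.LoopSound.add {C'' : Set (Finset (Lit α))} {l : Lit α} {i : ℕ}
    (hG : G.LoopSound v A C'' l i) {c : Clause α} {S : Set (Vertex α)}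
    (hc : (some i, c) ∈ A → ∀ t, c.HoldsAt v t ∨ ∃ R ∈ C'',
      (some i, .global ∅ (insert l R)) ∈ A ∧ ¬ DisjHolds v (t + 1) (insert l R)) :
    (G.add (some i) c S).LoopSound v A C'' l i where
  sound := hG.sound.add_loop hG.lt
  lt := hG.lt
  holdsAt c' hc' hA := by
    rcases hc' with h | h
    · obtain rfl : c' = c := congrArg Prod.snd h
      exact hc hA
    · exact hG.holdsAt c' h hA

/-- Copies from the main partition are true outright. Only `init_c` uses the second alternative, and
its clause can be blamed on itself. -/
theorem LoopInitStep.loopSound {C'' : Set (Finset (Lit α))} {l : Lit α} {i : ℕ}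
    (h : LoopInitStep C'' l i G G') (hA : G'.Closed A) (hG : G.LoopSound v A C'' l i) :
    G'.LoopSound v A C'' l i := by
  cases h with
  | init_x P Q h =>
    exact hG.add fun hcA t => .inl (hG.sound.valid _ h (hA.mem_of_add hcA (by simp)) t)
  | init_n P h =>
    exact hG.add fun hcA t => .inl (.inr ((hG.sound.valid _ h
      (hA.mem_of_add hcA (by simp)) (t + 1)).resolve_right not_disjHolds_empty))
  | init_c P h =>
    refine hG.add fun hcA t => ?_
    by_cases hP : DisjHolds v (t + 1) (insert l P)
    · exact .inl (.inr hP)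
    · exact .inr ⟨P, h, hcA, hP⟩

theorem LoopSatStep.loopSound {C'' : Set (Finset (Lit α))} {l : Lit α} {i : ℕ}
    (h : LoopSatStep i G G') (hA : G'.Closed A) (hG : G.LoopSound v A C'' l i) :
    G'.LoopSound v A C'' l i := by
  obtain ⟨c₁, h₁, c₂, h₂, c, hc, -, rfl⟩ := h
  refine hG.add fun hcA t => ?_
  rcases hG.holdsAt c₁ h₁ (hA.mem_of_add hcA (by simp)) t with h₁ | h₁
  · rcases hG.holdsAt c₂ h₂ (hA.mem_of_add hcA (by simp)) t with h₂ | h₂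
    · exact .inl (hc.holdsAt h₁ h₂)
    · exact .inr h₂
  · exact .inr h₁

/-- Soundness after a loop has been found in partition `i`: `G (P ∨ X G ¬ l)` is valid for the
clauses `G (P)` of that partition in `A`. -/
structure ResGraph.FoundSound (G : ResGraph α) (v : ℕ → SAtom α → Prop) (A : Set (Vertex α))
    (l : Lit α) (i : ℕ) : Prop where
  sound : G.Sound v A
  never : ∀ P, P ∈ G.emptyX (some i) → (some i, .global P ∅) ∈ A →
    ∀ t, ¬ DisjHolds v t P → ∀ k, t < k → ¬ l.Holds v k

/-- A false `G (P)` leads to a false start clause one step later, and the subsumption edge turns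
that into another false clause of the same partition in `A`. Following this cycle refutes `l` at
every later time. The set `C''` is arbitrary: nothing about earlier iterations is used. -/
theorem LoopIteration.sound {l : Lit α} {C'' : Set (Finset (Lit α))}
    (h : LoopIteration l C'' G G') (hA : G'.Closed A) (hG : G.Sound v A) :
    G'.Sound v A ∧
      (Subsumes (G'.emptyX (some G.loops)) C'' → G'.FoundSound v A l G.loops) := by
  obtain ⟨G₁, G₂, D, h₁, h₂, hD, rfl⟩ := h
  have hA₂ : G₂.Closed A := hA.of_extends ⟨subset_rfl, Set.subset_union_left⟩
  have hA₁ : G₁.Closed A :=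
    hA₂.of_extends (reflTransGen_extends (fun _ _ h => h.extends) h₂.1)
  have hG₀ : G.newLoop.LoopSound v A C'' l G.loops :=
    { sound := ⟨hG.valid, fun i c hc => (hG.bound i c hc).trans (Nat.lt_succ_self _)⟩
      lt := Nat.lt_succ_self _
      -- The partition just created is empty, because all existing loop indices lie below `G.loops`.
      holdsAt := fun c hc => absurd (hG.bound _ c hc) (lt_irrefl _) }
  have hG₁ := reflTransGen_invariant (I := fun G' => G'.LoopSound v A C'' l G.loops)
    (fun _ _ h => h.extends) (fun _ _ h => h.loopSound) h₁.1 hA₁ hG₀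
  have hG₂ := reflTransGen_invariant (I := fun G' => G'.LoopSound v A C'' l G.loops)
    (fun _ _ h => h.extends) (fun _ _ h => h.loopSound) h₂.1 hA₂ hG₁
  refine ⟨⟨hG₂.sound.valid, hG₂.sound.bound⟩, fun hs =>
    ⟨⟨hG₂.sound.valid, hG₂.sound.bound⟩, ?_⟩⟩
  have next : ∀ P, P ∈ G₂.emptyX (some G.loops) → (some G.loops, .global P ∅) ∈ A →
      ∀ t, ¬ DisjHolds v t P → ¬ l.Holds v (t + 1) ∧ ∃ P', P' ∈ G₂.emptyX (some G.loops) ∧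
        (some G.loops, .global P' ∅) ∈ A ∧ ¬ DisjHolds v (t + 1) P' := by
    intro P hP hPA t ht
    -- The `X` part of `G (P)` is empty, so falsity of `P` at `t` leaves only the blame alternative.
    obtain ⟨R, hR, hRA, hRt⟩ := (hG₂.holdsAt _ hP hPA t).resolve_left
      fun h => h.elim ht not_disjHolds_empty
    obtain ⟨P', hP'⟩ := hD.total R hR (hs R hR)
    obtain ⟨hP'X, -, hP'R⟩ := hD.valid P' R hP'
    rw [disjHolds_insert, not_or] at hRt
    -- The recorded subsumption edge ends in the start clause of `R`, which is in `A`; closure puts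
    -- its source, the clause of `P'`, into `A`.
    exact ⟨hRt.1, P', hP'X, hA _ _ (.inr ⟨P', R, hP', rfl⟩) hRA, fun h => hRt.2 (h.mono hP'R)⟩
  intro P hP hPA t ht k hk
  obtain ⟨d, rfl⟩ := Nat.exists_eq_add_of_lt hk
  induction d generalizing P t with
  | zero => exact (next P hP hPA t ht).1
  | succ d ih =>
    obtain ⟨-, P', hP', hP'A, hP't⟩ := next P hP hPA t ht
    have := ih P' hP' hP'A (t + 1) hP't (by omega)
    rwa [show t + 1 + d + 1 = t + (d + 1) + 1 by omega] at this

/-- Only the final iteration of a successful search matters; earlier ones pass on nothing but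
soundness of the main partition. -/
theorem LoopSearch.sound {l : Lit α} {C'' : Set (Finset (Lit α))} {r : Option ℕ}
    (h : LoopSearch l C'' G r G') (hA : G'.Closed A) (hG : G.Sound v A) :
    G'.Sound v A ∧ ∀ i, r = some i → G'.FoundSound v A l i := by
  induction h with
  | found _ _ _ h hs =>
    have h' := h.sound hA hG
    refine ⟨h'.1, fun i hi => ?_⟩
    obtain rfl := Option.some.inj hi
    exact h'.2 hs
  | notFound _ _ _ h => exact ⟨(h.sound hA hG).1, nofun⟩
  | again _ _ _ _ _ h _ _ hr ih => exact ih hA (h.sound (hA.of_extends hr.extends) hG).1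

/-- If `P` is false at a time, `l` is false strictly afterwards. For `concl1`, the eventuality
clause then leaves `Q` or `l` now. For `concl2`, the promise of a later `l` is made by `w_l` itself,
so the eventuality clause is not needed. -/
theorem LoopConclStep.foundSound (hv : InterpretsWait v) {Q : Finset (Lit α)} {l : Lit α} {i : ℕ}
    (hQ : (none, .eventuality Q l) ∈ A → (Clause.eventuality Q l).Valid v)
    (h : LoopConclStep Q l i G G') (hA : G'.Closed A) (hG : G.FoundSound v A l i) :
    G'.FoundSound v A l i := by
  -- Conclusions go to the main partition only, so what is known about partition `i` survives.
  have emptyX_add : ∀ c S, (G.add none c S).emptyX (some i) = G.emptyX (some i) := by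
    intro c S
    ext P
    simp [ResGraph.emptyX, ResGraph.part, ResGraph.add]
  cases h with
  | concl1 P h =>
    refine ⟨hG.sound.add_main fun hcA t => .inl ?_, by rw [emptyX_add]; exact hG.never⟩
    have hP := hG.never P h (hA.mem_of_add hcA (by simp)) t
    have hQ := hQ (hA.mem_of_add hcA (by simp)) t
    simp only [disjHolds_union, disjHolds_singleton]
    rcases hQ with hQ | ⟨k, hk, hl⟩
    · exact .inl (.inr hQ)
    · rcases hk.eq_or_lt with rfl | hk
      · exact .inr hl
      · exact .inl (.inl (by_contra fun hPt => hP hPt k hk hl))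
  | concl2 P h =>
    refine ⟨hG.sound.add_main fun hcA t => ?_, by rw [emptyX_add]; exact hG.never⟩
    have hP := hG.never P h (hA.mem_of_add hcA (by simp)) (t + 1)
    simp only [Clause.HoldsAt, disjHolds_insert, disjHolds_singleton, Lit.holds_neg,
      Lit.holds_waitFor hv]
    by_cases hw : ∃ k, t < k ∧ l.Holds v k
    · obtain ⟨k, hk, hl⟩ := hw
      rcases (Nat.succ_le_of_lt hk).eq_or_lt with rfl | hk
      · exact .inr (.inl hl)
      · exact .inr (.inr (by_contra fun hPt => hP hPt k hk hl))
    · exact .inl hw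

theorem exhaust_loopConclStep_sound (hv : InterpretsWait v) {Q : Finset (Lit α)} {l : Lit α}
    {i : ℕ} (hQ : (none, .eventuality Q l) ∈ A → (Clause.eventuality Q l).Valid v)
    (h : Exhaust (LoopConclStep Q l i) G G') (hA : G'.Closed A) (hG : G.FoundSound v A l i) :
    G'.Sound v A :=
  (reflTransGen_invariant (I := fun G => G.FoundSound v A l i) (fun _ _ h => h.extends)
    (fun _ _ h => h.foundSound hv hQ) h.1 hA hG).sound

/-- The treated eventuality clauses come from the input list, not from a lookup in the graph, so
their validity enters as the hypothesis `hL`. -/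
theorem ForLoop.sound (hv : InterpretsWait v) {L : List (Clause α)} {r : Option Outcome}
    (h : ForLoop L G r G') (hL : ∀ c ∈ L, (none, c) ∈ A → c.Valid v) (hA : G'.Closed A)
    (hG : G.Sound v A) : G'.Sound v A := by
  induction h with
  | done => exact hG
  | notFound _ _ _ _ _ _ _ hl hr ih =>
    exact ih (fun c hc => hL c (.tail _ hc)) hA (hl.sound (hA.of_extends hr.extends) hG).1
  | foundUnsat _ _ _ _ _ _ _ _ hl hc hs =>
    have hA₂ := hA.of_extends (exhaust_satStep_extends hs)
    have hA₁ := hA₂.of_extends (exhaust_loopConclStep_extends hc)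
    exact exhaust_satStep_sound hs hA (exhaust_loopConclStep_sound hv (hL _ (.head _)) hc hA₂
      ((hl.sound hA₁ hG).2 _ rfl))
  | foundContinue _ _ _ _ _ _ _ _ _ _ hl hc hs _ hr ih =>
    have hA₃ := hA.of_extends hr.extends
    have hA₂ := hA₃.of_extends (exhaust_satStep_extends hs)
    have hA₁ := hA₂.of_extends (exhaust_loopConclStep_extends hc)
    exact ih (fun c hc => hL c (.tail _ hc)) hA (exhaust_satStep_sound hs hA₃
      (exhaust_loopConclStep_sound hv (hL _ (.head _)) hc hA₂ ((hl.sound hA₁ hG).2 _ rfl)))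

theorem WhileLoop.sound (hv : InterpretsWait v) {C : Finset (Clause α)} {M' : Set (Clause α)}
    {r : Outcome} (hC : ∀ c ∈ C, (none, c) ∈ A → c.Valid v) (h : WhileLoop C M' G r G')
    (hA : G'.Closed A) (hG : G.Sound v A) : G'.Sound v A := by
  induction h with
  | exit => exact hG
  | ret _ _ _ _ _ _ _ hL hf =>
    exact hf.sound hv (fun c hc => hC c ((hL c).1 hc).1) hA hG
  | again _ _ _ _ _ _ _ _ hL hf hr ih =>
    exact ih hA (hf.sound hv (fun c hc => hC c ((hL c).1 hc).1) (hA.of_extends hr.extends) hG)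

theorem TRRun.sound (hv : InterpretsWait v) {C : Finset (Clause α)} {r : Outcome}
    (hC : ∀ c ∈ C, (none, c) ∈ A → c.Valid v) (h : TRRun C r G) (hA : G.Closed A) :
    G.Sound v A := by
  have h₀ : (ResGraph.start C).Sound v A := ⟨fun c hc => hC c hc.2, fun i c hc => nomatch hc.1⟩
  cases h with
  | unsat₀ => exact h₀
  | unsat₁ _ _ h₁ => exact exhaust_satStep_sound h₁ hA h₀
  | unsat₂ _ _ _ _ h₁ _ h₂ h₃ =>
    have hA₂ := hA.of_extends (exhaust_satStep_extends h₃)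
    have hA₁ := hA₂.of_extends (exhaust_augStep_extends h₂)
    exact exhaust_satStep_sound h₃ hA
      (exhaust_augStep_sound hv h₂ hA₂ (exhaust_satStep_sound h₁ hA₁ h₀))
  | main _ _ _ _ _ _ h₁ _ h₂ h₃ _ h =>
    have hA₃ := hA.of_extends h.extends
    have hA₂ := hA₃.of_extends (exhaust_satStep_extends h₃)
    have hA₁ := hA₂.of_extends (exhaust_augStep_extends h₂)
    exact h.sound hv hC hA (exhaust_satStep_sound h₃ hA₃
      (exhaust_augStep_sound hv h₂ hA₂ (exhaust_satStep_sound h₁ hA₁ h₀)))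

/-- An unsatisfiable core in SNF is unsatisfiable. -/
theorem IsCoreInSNF.exists_not_valid (hv : InterpretsWait v) {C : Finset (Clause α)}
    {C' : Set (Clause α)} (h : IsCoreInSNF C C') : ∃ c ∈ C', c ∈ C ∧ ¬ c.Valid v := by
  obtain ⟨G, hG, c, hc, hce, rfl⟩ := h
  by_contra! hall
  -- All ancestors of the empty clause; a starting clause whose main vertex lies here belongs to the
  -- core.
  let A : Set (Vertex α) :=
    {u | Relation.ReflTransGen (fun u u' => (u, u') ∈ G.edges) u (none, c)}
  have hA : G.Closed A := fun u u' he hu' => .head he hu'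
  have hC : ∀ c ∈ C, (none, c) ∈ A → c.Valid v := fun c hc hcA =>
    hall c ⟨hc, hG.extends.verts ⟨rfl, hc⟩, hcA⟩ hc
  exact hce.not_valid ((hG.sound hv hC hA).valid c hc .refl)

end Soundness

/-! ## Models of the lifted formula are models of the core in SNF -/

section Lifting

variable {α : Type*}

/-- The immediate subformula occurrence in direction `d` with its polarity. -/
def LTL.child : Bool × LTL α → Bool → Option (Bool × LTL α)
  | (b, .neg ψ), false => some (!b, ψ)
  | (b, .next ψ), false | (b, .eventually ψ), false | (b, .always ψ), false => some (b, ψ)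
  | (b, .or ψ _), false | (b, .and ψ _), false | (b, .untl ψ _), false
  | (b, .release ψ _), false => some (b, ψ)
  | (b, .or _ χ), true | (b, .and _ χ), true | (b, .untl _ χ), true
  | (b, .release _ χ), true => some (b, χ)
  | _, _ => none

/-- The occurrence of a subformula of `φ` at position `p` with its polarity. -/
def LTL.occurrence (φ : LTL α) (p : List Bool) : Option (Bool × LTL α) :=
  p.foldlM LTL.child (true, φ)

theorem LTL.occurrence_append {φ ψ : LTL α} {p : List Bool} {b : Bool}
    (h : φ.occurrence p = some (b, ψ)) (d : Bool) :
    φ.occurrence (p ++ [d]) = LTL.child (b, ψ) d := by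
  have h' : List.foldlM LTL.child (true, φ) p = some (b, ψ) := h
  simp [LTL.occurrence, List.foldlM_append, h']

/-- The truth value of a signed scheme literal when the propositions are interpreted by `e`. -/
def SLit.Holds (e : Src → ℕ → Prop) (t : ℕ) (l : SLit) : Prop := e l.2 t ↔ l.1 = true

def Scheme.HoldsAt (e : Src → ℕ → Prop) (t : ℕ) : Scheme → Prop
  | .step P Q => (∃ l ∈ P, SLit.Holds e t l) ∨ ∃ l ∈ Q, SLit.Holds e (t + 1) l
  | .ev P l => (∃ l ∈ P, SLit.Holds e t l) ∨ ∃ k, t ≤ k ∧ SLit.Holds e k l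

/-- Agreement is demanded only for sources that occur in the scheme, since an unused subformula may
have been replaced by a constant. It is demanded at all times because schemes look ahead. -/
theorem Scheme.HoldsAt.congr {e e' : Src → ℕ → Prop} {t : ℕ} {r : Scheme}
    (h : r.HoldsAt e t) (hee' : ∀ l ∈ r.lits, e l.2 = e' l.2) : r.HoldsAt e' t := by
  have key : ∀ l ∈ r.lits, ∀ t, SLit.Holds e t l → SLit.Holds e' t l := by
    intro l hl t h
    unfold SLit.Holds at h ⊢
    rwa [← hee' l hl]
  cases r with
  | step P Q =>
    rcases h with ⟨l, hl, h⟩ | ⟨l, hl, h⟩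
    · exact .inl ⟨l, hl, key l (List.mem_append_left _ hl) _ h⟩
    · exact .inr ⟨l, hl, key l (List.mem_append_right _ hl) _ h⟩
  | ev P l =>
    rcases h with ⟨l, hl, h⟩ | ⟨k, hk, h⟩
    · exact .inl ⟨l, hl, key l (List.mem_append_left _ hl) _ h⟩
    · exact .inr ⟨k, hk, key l (List.mem_append_right _ (by simp)) _ h⟩

def Ref.Holds (v : ℕ → SAtom α → Prop) (t : ℕ) : Ref α → Prop
  | .const b => b = true
  | .prop p => v t p

/-- The truth value of a disjunct of an unsimplified clause. -/
def SignedHolds (v : ℕ → SAtom α → Prop) (t : ℕ) : Bool ⊕ Lit α → Prop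
  | .inl b => b = true
  | .inr l => l.Holds v t

theorem signedHolds_signed {v : ℕ → SAtom α → Prop} {t : ℕ} {r : Ref α} {s : Bool} :
    SignedHolds v t (r.signed s) ↔ (r.Holds v t ↔ s = true) := by
  cases r with
  | const b => cases b <;> cases s <;> simp [Ref.signed, SignedHolds, Ref.Holds]
  | prop p => simp [Ref.signed, SignedHolds, Ref.Holds, Lit.Holds]

/-! ### One-step unfoldings of the temporal operators, and the eventualities they imply. -/

theorem LTL.holds_eventually_iff {w : ℕ → Set α} {ψ : LTL α} {t : ℕ} :
    (eventually ψ).Holds w t ↔ ψ.Holds w t ∨ (eventually ψ).Holds w (t + 1) := by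
  constructor
  · rintro ⟨k, hk, h⟩
    rcases hk.eq_or_lt with rfl | hk
    · exact .inl h
    · exact .inr ⟨k, hk, h⟩
  · rintro (h | ⟨k, hk, h⟩)
    · exact ⟨t, le_rfl, h⟩
    · exact ⟨k, by omega, h⟩

theorem LTL.holds_always_iff {w : ℕ → Set α} {ψ : LTL α} {t : ℕ} :
    (always ψ).Holds w t ↔ ψ.Holds w t ∧ (always ψ).Holds w (t + 1) := by
  refine ⟨fun h => ⟨h t le_rfl, fun k hk => h k (by omega)⟩, fun h k hk => ?_⟩
  rcases hk.eq_or_lt with rfl | hk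
  · exact h.1
  · exact h.2 k hk

theorem LTL.holds_untl_iff {w : ℕ → Set α} {ψ χ : LTL α} {t : ℕ} :
    (untl ψ χ).Holds w t ↔ χ.Holds w t ∨ ψ.Holds w t ∧ (untl ψ χ).Holds w (t + 1) := by
  constructor
  · rintro ⟨k, hk, hχ, hψ⟩
    rcases hk.eq_or_lt with rfl | hk
    · exact .inl hχ
    · exact .inr ⟨hψ t le_rfl hk, k, hk, hχ, fun j hj => hψ j (by omega)⟩
  · rintro (hχ | ⟨hψ, k, hk, hχ, hψ'⟩)
    · exact ⟨t, le_rfl, hχ, fun j hj hj' => by omega⟩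
    · refine ⟨k, by omega, hχ, fun j hj hj' => ?_⟩
      rcases hj.eq_or_lt with rfl | hj
      · exact hψ
      · exact hψ' j hj hj'

theorem LTL.holds_release_iff {w : ℕ → Set α} {ψ χ : LTL α} {t : ℕ} :
    (release ψ χ).Holds w t ↔
      χ.Holds w t ∧ (ψ.Holds w t ∨ (release ψ χ).Holds w (t + 1)) := by
  constructor
  · intro h
    refine ⟨(h t le_rfl).resolve_right fun ⟨j, hj, hj', _⟩ => by omega, ?_⟩
    refine or_iff_not_imp_left.2 fun hψ k hk => (h k (by omega)).imp_right ?_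
    rintro ⟨j, hj, hj', hψj⟩
    rcases hj.eq_or_lt with rfl | hj
    · exact absurd hψj hψ
    · exact ⟨j, hj, hj', hψj⟩
  · rintro ⟨hχ, h⟩ k hk
    rcases hk.eq_or_lt with rfl | hk
    · exact .inl hχ
    rcases h with hψ | h
    · exact .inr ⟨t, le_rfl, hk, hψ⟩
    · exact (h k hk).imp_right fun ⟨j, hj, hj', hψj⟩ => ⟨j, by omega, hj', hψj⟩

theorem LTL.exists_of_holds_untl {w : ℕ → Set α} {ψ χ : LTL α} {t : ℕ}
    (h : (untl ψ χ).Holds w t) : ∃ k, t ≤ k ∧ χ.Holds w k :=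
  let ⟨k, hk, hχ, _⟩ := h
  ⟨k, hk, hχ⟩

theorem LTL.exists_of_not_holds_release {w : ℕ → Set α} {ψ χ : LTL α} {t : ℕ}
    (h : ¬ (release ψ χ).Holds w t) : ∃ k, t ≤ k ∧ ¬ χ.Holds w k := by
  by_contra! hall
  exact h fun k hk => .inl (hall k hk)

theorem LTL.exists_of_not_holds_always {w : ℕ → Set α} {ψ : LTL α} {t : ℕ}
    (h : ¬ (always ψ).Holds w t) : ∃ k, t ≤ k ∧ ¬ ψ.Holds w k := by
  by_contra! hall
  exact h hall

/-! ### Simplification of Boolean constants preserves truth. -/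

variable [DecidableEq α]

theorem disjHolds_of_disj {v : ℕ → SAtom α → Prop} {t : ℕ} {L : List (Bool ⊕ Lit α)}
    {P : Finset (Lit α)} (hP : disj L = some P) (h : ∃ x ∈ L, SignedHolds v t x) :
    DisjHolds v t P := by
  induction L generalizing P with
  | nil => simp at h
  | cons x L ih =>
    simp only [List.mem_cons, exists_eq_or_imp] at h
    rcases x with (_ | _) | l
    · exact ih hP (h.resolve_left (by simp [SignedHolds]))
    · simp [disj] at hP
    · obtain ⟨Q, hQ, rfl⟩ := Option.map_eq_some_iff.1 hP
      rw [disjHolds_insert]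
      exact h.imp id (ih hQ)

theorem disjHolds_of_disj_map {v : ℕ → SAtom α → Prop} {t : ℕ} {env : Src → Ref α}
    {L : List SLit} {P : Finset (Lit α)}
    (hP : disj (L.map fun l => (env l.2).signed l.1) = some P)
    (h : ∃ l ∈ L, SLit.Holds (fun s t => (env s).Holds v t) t l) : DisjHolds v t P := by
  obtain ⟨l, hl, h⟩ := h
  exact disjHolds_of_disj hP ⟨_, List.mem_map_of_mem hl, signedHolds_signed.2 h⟩

theorem Scheme.HoldsAt.inst {v : ℕ → SAtom α → Prop} {t : ℕ} {env : Src → Ref α} {r : Scheme}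
    {c : Clause α} (h : r.HoldsAt (fun s t => (env s).Holds v t) t) (hc : r.inst env = some c) :
    c.HoldsAt v t := by
  cases r with
  | step P Q =>
    simp only [Scheme.inst] at hc
    split at hc
    · next P' Q' hP hQ =>
      obtain rfl := Option.some.inj hc
      exact h.imp (disjHolds_of_disj_map hP) (disjHolds_of_disj_map hQ)
    · cases hc
  | ev P l =>
    have hl : ∀ k, SLit.Holds (fun s t => (env s).Holds v t) k l →
        SignedHolds v k ((env l.2).signed l.1) := fun k h => signedHolds_signed.2 h
    simp only [Scheme.inst] at hc
    split at hc
    · cases hc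
    · cases hc
    -- The eventuality literal is the constant `0`, so the truth of the scheme must come from `P`.
    · next P' hP hs =>
      obtain rfl := Option.some.inj hc
      refine .inl (h.elim (disjHolds_of_disj_map hP) fun ⟨k, _, hk⟩ => ?_)
      have := hl k hk
      rw [hs] at this
      cases this
    · next P' l' hP hs =>
      obtain rfl := Option.some.inj hc
      refine h.imp (disjHolds_of_disj_map hP) fun ⟨k, hk, hkl⟩ => ⟨k, hk, ?_⟩
      have := hl k hkl
      rwa [hs] at this

open Classical in
/-- The formula that takes the place of the immediate subformula occurrence `ψ'` of polarity `b'`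
at position `p'` when the core `C` is lifted, where `u` tells whether `ψ'` is used. -/
noncomputable def LTL.liftChild (C : Set (Clause α)) (u : Prop) (p' : List Bool) (b' : Bool)
    (ψ' : LTL α) : LTL α :=
  if u then LTL.liftAux C p' b' ψ' else LTL.ofBool b'

/-- The truth values of the lifted occurrence of `ψ` and of what takes the place of its immediate
subformula occurrences. -/
noncomputable def LTL.liftInterp (w : ℕ → Set α) (C : Set (Clause α)) (p : List Bool) (b : Bool)
    (ψ : LTL α) : Src → ℕ → Prop
  | .self => (LTL.liftAux C p b ψ).Holds w
  | .fst =>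
    match LTL.child (b, ψ) false with
    | some (b', ψ') => (LTL.liftChild C (LTL.Uses C p b ψ .fst) (p ++ [false]) b' ψ').Holds w
    | none => fun _ => True
  | .snd =>
    match LTL.child (b, ψ) true with
    | some (b', ψ') => (LTL.liftChild C (LTL.Uses C p b ψ .snd) (p ++ [true]) b' ψ').Holds w
    | none => fun _ => True

/-- The clause schemes of the translation hold for the lifted formula. -/
theorem LTL.holdsAt_of_mem_schemes (w : ℕ → Set α) (C : Set (Clause α)) (p : List Bool) (b : Bool)
    (ψ : LTL α) {r : Scheme} (hr : r ∈ LTL.schemes b ψ) (t : ℕ) :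
    r.HoldsAt (LTL.liftInterp w C p b ψ) t := by
  cases ψ with
  | tru | fls | atom => cases b <;> simp [schemes] at hr
  | neg ψ =>
    have h : (liftAux C p b (neg ψ)).Holds w t ↔
      ¬ (liftChild C (Uses C p b (neg ψ) .fst) (p ++ [false]) (!b) ψ).Holds w t := Iff.rfl
    cases b <;> simp only [schemes, List.mem_cons, List.not_mem_nil, or_false] at hr <;>
      subst hr <;> simp [Scheme.HoldsAt, SLit.Holds, liftInterp, child] <;> tauto
  | or ψ χ =>
    have h : (liftAux C p b (or ψ χ)).Holds w t ↔
      (liftChild C (Uses C p b (or ψ χ) .fst) (p ++ [false]) b ψ).Holds w t ∨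
      (liftChild C (Uses C p b (or ψ χ) .snd) (p ++ [true]) b χ).Holds w t := Iff.rfl
    cases b <;> simp only [schemes, List.mem_cons, List.not_mem_nil, or_false] at hr <;>
      rcases hr with rfl | rfl <;>
      simp [Scheme.HoldsAt, SLit.Holds, liftInterp, child] <;> tauto
  | and ψ χ =>
    have h : (liftAux C p b (and ψ χ)).Holds w t ↔
      (liftChild C (Uses C p b (and ψ χ) .fst) (p ++ [false]) b ψ).Holds w t ∧
      (liftChild C (Uses C p b (and ψ χ) .snd) (p ++ [true]) b χ).Holds w t := Iff.rfl
    cases b <;> simp only [schemes, List.mem_cons, List.not_mem_nil, or_false] at hr <;>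
      rcases hr with rfl | rfl <;>
      simp [Scheme.HoldsAt, SLit.Holds, liftInterp, child] <;> tauto
  | next ψ =>
    have h : (liftAux C p b (next ψ)).Holds w t ↔
      (liftChild C (Uses C p b (next ψ) .fst) (p ++ [false]) b ψ).Holds w (t + 1) := Iff.rfl
    cases b <;> simp only [schemes, List.mem_cons, List.not_mem_nil, or_false] at hr <;>
      subst hr <;> simp [Scheme.HoldsAt, SLit.Holds, liftInterp, child] <;> tauto
  | eventually ψ =>
    have e : liftAux C p b (eventually ψ) =
      eventually (liftChild C (Uses C p b (eventually ψ) .fst) (p ++ [false]) b ψ) := rfl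
    -- The unfolding `h` yields the step schemes and `h'` the eventuality scheme; the rest is
    -- propositional. The remaining cases follow the same pattern.
    have h := holds_eventually_iff (w := w) (t := t)
      (ψ := liftChild C (Uses C p b (eventually ψ) .fst) (p ++ [false]) b ψ)
    have h' : (eventually (liftChild C (Uses C p b (eventually ψ) .fst) (p ++ [false]) b ψ)).Holds
      w t ↔ ∃ k, t ≤ k ∧
        (liftChild C (Uses C p b (eventually ψ) .fst) (p ++ [false]) b ψ).Holds w k := Iff.rfl
    cases b <;> simp only [schemes, List.mem_cons, List.not_mem_nil, or_false] at hr <;>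
      rcases hr with rfl | rfl <;>
      simp only [Scheme.HoldsAt, SLit.Holds, liftInterp, child, e, List.mem_cons,
        List.not_mem_nil, or_false, false_and, exists_false, exists_eq_or_imp, exists_eq_left,
        Bool.false_eq_true, iff_false, iff_true] <;> tauto
  | always ψ =>
    have e : liftAux C p b (always ψ) =
      always (liftChild C (Uses C p b (always ψ) .fst) (p ++ [false]) b ψ) := rfl
    have h := holds_always_iff (w := w) (t := t)
      (ψ := liftChild C (Uses C p b (always ψ) .fst) (p ++ [false]) b ψ)
    have h' := exists_of_not_holds_always (w := w) (t := t)
      (ψ := liftChild C (Uses C p b (always ψ) .fst) (p ++ [false]) b ψ)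
    cases b <;> simp only [schemes, List.mem_cons, List.not_mem_nil, or_false] at hr <;>
      rcases hr with rfl | rfl <;>
      simp only [Scheme.HoldsAt, SLit.Holds, liftInterp, child, e, List.mem_cons,
        List.not_mem_nil, or_false, false_and, exists_false, exists_eq_or_imp, exists_eq_left,
        Bool.false_eq_true, iff_false, iff_true] <;> tauto
  | untl ψ χ =>
    have e : liftAux C p b (untl ψ χ) =
      untl (liftChild C (Uses C p b (untl ψ χ) .fst) (p ++ [false]) b ψ)
        (liftChild C (Uses C p b (untl ψ χ) .snd) (p ++ [true]) b χ) := rfl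
    have h := holds_untl_iff (w := w) (t := t)
      (ψ := liftChild C (Uses C p b (untl ψ χ) .fst) (p ++ [false]) b ψ)
      (χ := liftChild C (Uses C p b (untl ψ χ) .snd) (p ++ [true]) b χ)
    have h' := exists_of_holds_untl (w := w) (t := t)
      (ψ := liftChild C (Uses C p b (untl ψ χ) .fst) (p ++ [false]) b ψ)
      (χ := liftChild C (Uses C p b (untl ψ χ) .snd) (p ++ [true]) b χ)
    cases b <;> simp only [schemes, List.mem_cons, List.not_mem_nil, or_false] at hr <;>
      rcases hr with rfl | rfl | rfl <;>
      simp only [Scheme.HoldsAt, SLit.Holds, liftInterp, child, e, List.mem_cons,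
        List.not_mem_nil, or_false, false_and, exists_false, exists_eq_or_imp, exists_eq_left,
        Bool.false_eq_true, iff_false, iff_true] <;> tauto
  | release ψ χ =>
    have e : liftAux C p b (release ψ χ) =
      release (liftChild C (Uses C p b (release ψ χ) .fst) (p ++ [false]) b ψ)
        (liftChild C (Uses C p b (release ψ χ) .snd) (p ++ [true]) b χ) := rfl
    have h := holds_release_iff (w := w) (t := t)
      (ψ := liftChild C (Uses C p b (release ψ χ) .fst) (p ++ [false]) b ψ)
      (χ := liftChild C (Uses C p b (release ψ χ) .snd) (p ++ [true]) b χ)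
    have h' := exists_of_not_holds_release (w := w) (t := t)
      (ψ := liftChild C (Uses C p b (release ψ χ) .fst) (p ++ [false]) b ψ)
      (χ := liftChild C (Uses C p b (release ψ χ) .snd) (p ++ [true]) b χ)
    cases b <;> simp only [schemes, List.mem_cons, List.not_mem_nil, or_false] at hr <;>
      rcases hr with rfl | rfl | rfl <;>
      simp only [Scheme.HoldsAt, SLit.Holds, liftInterp, child, e, List.mem_cons,
        List.not_mem_nil, or_false, false_and, exists_false, exists_eq_or_imp, exists_eq_left,
        Bool.false_eq_true, iff_false, iff_true] <;> tauto

/-- The interpretation of the propositions of the SNF of `φ` in which the proposition of each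
occurrence of a subformula is interpreted by the lifted occurrence over the word `w`. -/
def LTL.coreInterp (w : ℕ → Set α) (C : Set (Clause α)) (φ : LTL α) (t : ℕ) : SAtom α → Prop
  | .ap a => a ∈ w t
  | .x p => ∃ b ψ, φ.occurrence p = some (b, ψ) ∧ (LTL.liftAux C p b ψ).Holds w t
  | .wait s q => ∃ k, t < k ∧ (LTL.coreInterp w C φ k q ↔ s = true)

theorem LTL.interpretsWait_coreInterp (w : ℕ → Set α) (C : Set (Clause α)) (φ : LTL α) :
    InterpretsWait (φ.coreInterp w C) := by
  intro t s p
  rw [LTL.coreInterp]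

/-- Constants and atoms are their own lifts; for the other formulas, the position determines the
occurrence and its polarity. -/
theorem LTL.ref_holds_iff {w : ℕ → Set α} {C : Set (Clause α)} {φ ψ : LTL α} {p : List Bool}
    {b : Bool} (h : φ.occurrence p = some (b, ψ)) (t : ℕ) :
    (ψ.ref p).Holds (φ.coreInterp w C) t ↔ (LTL.liftAux C p b ψ).Holds w t := by
  cases ψ <;> simp [LTL.ref, Ref.Holds, LTL.coreInterp, h] <;> simp [LTL.liftAux, LTL.Holds]

/-- A used subformula is replaced by its own lift, which is exactly how its proposition is
interpreted. An unused one becomes a constant, and the two may differ; hence the hypothesis `hs`. -/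
theorem LTL.liftInterp_eq {w : ℕ → Set α} {C : Set (Clause α)} {φ ψ : LTL α} {p : List Bool}
    {b : Bool} (h : φ.occurrence p = some (b, ψ)) {s : Src}
    (hs : s = .self ∨ LTL.Uses C p b ψ s) :
    LTL.liftInterp w C p b ψ s = fun t => (ψ.env p s).Holds (φ.coreInterp w C) t := by
  have hc : ∀ d b' ψ', LTL.child (b, ψ) d = some (b', ψ') →
      (LTL.liftAux C (p ++ [d]) b' ψ').Holds w =
        fun t => (ψ'.ref (p ++ [d])).Holds (φ.coreInterp w C) t := by
    intro d b' ψ' hd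
    ext t
    exact (LTL.ref_holds_iff ((LTL.occurrence_append h d).trans hd) t).symm
  cases s with
  | self =>
    ext t
    exact (LTL.ref_holds_iff h t).symm
  | fst =>
    replace hs := hs.resolve_left nofun
    cases ψ <;> first
      -- No subformula in this direction: both sides default to truth.
      | exact funext fun t => (eq_true (rfl : true = true)).symm
      | simp only [LTL.liftInterp, LTL.child, LTL.liftChild, if_pos hs, LTL.env]
        exact hc false _ _ rfl
  | snd =>
    replace hs := hs.resolve_left nofun
    cases ψ <;> first
      | exact funext fun t => (eq_true (rfl : true = true)).symm
      | simp only [LTL.liftInterp, LTL.child, LTL.liftChild, if_pos hs, LTL.env]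
        exact hc true _ _ rfl

/-- The clause `c`, being in `C`, witnesses `LTL.Uses` for every source in its own scheme. This is
where the lifting rule fits the core. -/
theorem LTL.valid_of_mem_nodeClauses {w : ℕ → Set α} {C : Set (Clause α)} {φ ψ : LTL α}
    {p : List Bool} {b : Bool} (h : φ.occurrence p = some (b, ψ)) {c : Clause α} (hc : c ∈ C)
    (hcψ : c ∈ LTL.nodeClauses p b ψ) : c.Valid (φ.coreInterp w C) := by
  obtain ⟨r, hr, hrc⟩ := List.mem_filterMap.1 hcψ
  intro t
  refine ((LTL.holdsAt_of_mem_schemes w C p b ψ hr t).congr fun l hl => ?_).inst hrc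
  exact LTL.liftInterp_eq h (.inr ⟨r, hr, ⟨l.1, hl⟩, c, hc, hrc⟩)

theorem LTL.valid_of_mem_snfAux {w : ℕ → Set α} {C : Set (Clause α)} {φ ψ : LTL α}
    {p : List Bool} {b : Bool} (h : φ.occurrence p = some (b, ψ)) {c : Clause α} (hc : c ∈ C)
    (hcψ : c ∈ LTL.snfAux p b ψ) : c.Valid (φ.coreInterp w C) := by
  have hn := LTL.valid_of_mem_nodeClauses (w := w) h hc
  have hd := LTL.occurrence_append h
  induction ψ generalizing p b with
  | tru | fls | atom => simp [LTL.snfAux] at hcψ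
  | neg ψ ih | next ψ ih | eventually ψ ih | always ψ ih =>
    rcases List.mem_append.1 hcψ with hcψ | hcψ
    · exact hn hcψ
    · have hf := hd false
      exact ih hf hcψ (LTL.valid_of_mem_nodeClauses hf hc) (LTL.occurrence_append hf)
  | or ψ χ ihψ ihχ | and ψ χ ihψ ihχ | untl ψ χ ihψ ihχ | release ψ χ ihψ ihχ =>
    rcases List.mem_append.1 hcψ with hcψ | hcψ
    · rcases List.mem_append.1 hcψ with hcψ | hcψ
      · exact hn hcψ
      · have hf := hd false
        exact ihψ hf hcψ (LTL.valid_of_mem_nodeClauses hf hc) (LTL.occurrence_append hf)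
    · have ht := hd true
      exact ihχ ht hcψ (LTL.valid_of_mem_nodeClauses ht hc) (LTL.occurrence_append ht)

/-- A model of the lifted formula yields a model of the clauses of the SNF that are in `C`. -/
theorem LTL.valid_of_mem_snf {w : ℕ → Set α} {C : Set (Clause α)} {φ : LTL α}
    (hw : (φ.lift C).Holds w 0) {c : Clause α} (hc : c ∈ C) (hcφ : c ∈ φ.snf) :
    c.Valid (φ.coreInterp w C) := by
  have h : φ.occurrence [] = some (true, φ) := rfl
  rcases Finset.mem_union.1 hcφ with hcφ | hcφ
  · rw [Option.mem_toFinset, Option.mem_def, Option.map_eq_some_iff] at hcφ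
    obtain ⟨P, hP, rfl⟩ := hcφ
    -- The root is never replaced, so `x_φ` at time `0` is the truth of the lifted formula.
    exact fun _ => disjHolds_of_disj hP
      ⟨_, List.mem_singleton_self _, signedHolds_signed.2
        (iff_of_true ((LTL.ref_holds_iff h 0).2 hw) rfl)⟩
  · exact LTL.valid_of_mem_snfAux h hc (List.mem_toFinset.1 hcφ)

end Lifting

theorem mainTheorem2 {α : Type*} [DecidableEq α] (φ φuc : LTL α) (hφ : ¬ φ.Satisfiable)
    (huc : IsCoreInLTL φ φuc) : ¬ φuc.Satisfiable := by
  obtain ⟨C, hC, rfl⟩ := huc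
  rintro ⟨w, hw⟩
  obtain ⟨c, hc, hcφ, hcv⟩ := hC.exists_not_valid (LTL.interpretsWait_coreInterp w C φ)
  exact hcv (LTL.valid_of_mem_snf hw hc hcφ)
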